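/- A continuum is a nonempty compact connected metrizable space. For continuous maps $\varphi_i:[0,1]\to[0,1]$ $(i\in\mathbb{N})$ the inverse limit is the subspace $\{(x_i)_{i\in\mathbb{N}} : \varphi_i(x_{i+1})=x_i \text{ for all } i\in\mathbb{N}\}$ of the product $[0,1]^{\mathbb{N}}$. A continuum is arc-like if it is homeomorphic to such an inverse limit. For a map $T$ write $\operatorname{Fix}(T)$ for its set of fixed points. There exist an arc-like continuum $X$ and homeomorphisms $F,G:X\to X$ such that $F\circ G=G\circ F$ and $\operatorname{Fix}(F)\cap\operatorname{Fix}(G)=\emptyset$. More precisely: (1) There exist continuous surjections $f,g:[0,1]\to[0,1]$ such that $f\circ g=g\circ f$ and $\operatorname{Fix}(f)\cap\operatorname{Fix}(g)=\emptyset$ (Boyce, Huneke). (2) For every pair $f,g$ as in (1), put $h=f\circ g$ and $$X=\{(x_i)_{i\in\mathbb{N}}\in[0,1]^{\mathbb{N}} : h(x_{i+1})=x_i \text{ for all } i\in\mathbb{N}\}.$$ Then $X$ is an arc-like continuum, and $F((x_i)_i)=(f(x_i))_i$ and $G((x_i)_i)=(g(x_i))_i$ define homeomorphisms $F,G:X\to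 X$ with $F\circ G=G\circ F$ and $\operatorname{Fix}(F)\cap\operatorname{Fix}(G)=\emptyset$. -/

import Mathlib

open scoped unitInterval

/-- The inverse limit of the sequence of arcs `I ← I ← I ← ⋯` with continuous bonding maps `φ i`,
as a subspace of the countable product `I × I × ⋯` (with the product topology). -/
def inverseLimit (φ : ℕ → C(I, I)) : Set (ℕ → I) :=
  {x | ∀ i, φ i (x (i + 1)) = x i}

/-- A continuum: a (nonempty) compact connected metrizable space. -/
structure IsContinuum (X : Type*) [TopologicalSpace X] : Prop where
  compact : CompactSpace X
  connected : ConnectedSpace X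
  metrizable : TopologicalSpace.MetrizableSpace X

/-- An arc-like continuum: a continuum homeomorphic to an inverse limit of arcs. -/
structure IsArcLikeContinuum (X : Type*) [TopologicalSpace X] : Prop where
  isContinuum : IsContinuum X
  exists_homeomorph : ∃ φ : ℕ → C(I, I), Nonempty (X ≃ₜ inverseLimit φ)

/-- `f` and `g` are commuting surjections of the unit interval without a common fixed point. -/
structure IsCommutingSurjectionPair (f g : C(I, I)) : Prop where
  surjective_left : Function.Surjective f
  surjective_right : Function.Surjective g
  comm : f.comp g = g.comp f
  no_common_fixed : Function.fixedPoints f ∩ Function.fixedPoints g = ∅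

open Topology BoundedContinuousFunction

/-! Interval maps: on `[0, 7]`, cut into unit pieces, one of `f`, `g` is affine on each piece. The
other is then forced by commutation: if `f` is affine at `x`, set `g x = s (g (f x))` with `s` an
inverse branch of `f` of slope `1/7` in absolute value, and symmetrically. These self-referential
equations decouple into one for `f` and one for `g`, each a `1/7`-contraction in the sup norm, so
Banach's theorem solves them. The branches are placed so that no piece contains a common fixed
point.

Inverse limit: `h = f ∘ g` acts on `X` as the inverse of the shift. As `f` and `g` commute, `F ∘ G =
G ∘ F` is that invertible map, so both factors are invertible. Coordinate 0 of a common fixed point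
of `F`, `G` would be one of `f`, `g`. Connectedness of `X` comes from writing it as a nested
intersection of continuous images of the Hilbert cube. -/

theorem exists_fixedPoint_of_pointwise_contraction {S : Set (ℝ →ᵇ ℝ)} (hS : IsClosed S)
    (hne : S.Nonempty) (T : (ℝ → ℝ) → ℝ → ℝ) (hT : ∀ u ∈ S, ∃ v ∈ S, ⇑v = T u)
    (hc : ∀ u v : ℝ →ᵇ ℝ, ∀ x, |T u x - T v x| ≤ dist u v / 7) : ∃ u ∈ S, T u = u := by
  choose! R hRS hR using hT
  have hmaps : Set.MapsTo R S S := fun u hu => hRS u hu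
  have hcon : ContractingWith (1 / 7 : NNReal) (hmaps.restrict R S S) := by
    refine ⟨by rw [← NNReal.coe_lt_coe]; norm_num, LipschitzWith.of_dist_le_mul fun u v => ?_⟩
    change dist (R u) (R v) ≤ _ * dist (u : ℝ →ᵇ ℝ) v
    refine (BoundedContinuousFunction.dist_le (by positivity)).2 fun x => ?_
    rw [hR _ u.2, hR _ v.2, Real.dist_eq]
    refine (hc u v x).trans (le_of_eq ?_)
    push_cast
    ring
  obtain ⟨u₀, hu₀⟩ := hne
  obtain ⟨u, hu, hfix, -⟩ := hcon.exists_fixedPoint' hS.isComplete hmaps hu₀ (edist_ne_top _ _)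
  exact ⟨u, hu, by rw [← hR u hu, hfix]⟩

/-! ### Self-similar operators on functions on `[0, 7]` -/

/-- The retraction of the line onto `[0, 7]`. -/
noncomputable def clampSeven (x : ℝ) : ℝ := max 0 (min x 7)

theorem continuous_clampSeven : Continuous clampSeven := by
  unfold clampSeven; fun_prop

theorem clampSeven_nonneg (x : ℝ) : 0 ≤ clampSeven x := le_max_left _ _

theorem clampSeven_le (x : ℝ) : clampSeven x ≤ 7 := max_le (by norm_num) (min_le_right _ _)

theorem clampSeven_of_mem {x : ℝ} (h0 : 0 ≤ x) (h7 : x ≤ 7) : clampSeven x = x := by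
  rw [clampSeven, min_eq_left h7, max_eq_right h0]

/-- The operator on functions on the line whose fixed point gives the first commuting map. -/
noncomputable def leftOperator (u : ℝ → ℝ) (x : ℝ) : ℝ :=
  if x ≤ 1 then 7 * x else if x ≤ 2 then 9 - 2 * x else if x ≤ 3 then 5 - u (18 - 6 * x) / 7
  else if x ≤ 4 then 5 - u (7 * x - 21) / 7 else if x ≤ 5 then 3 + u (35 - 7 * x) / 7
  else if x ≤ 6 then 18 - 3 * x else 7 * x - 42

/-- The operator on functions on the line whose fixed point gives the second commuting map. -/
noncomputable def rightOperator (u : ℝ → ℝ) (x : ℝ) : ℝ :=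
  if x ≤ 1 then 6 + u (7 * x) / 7 else if x ≤ 2 then 6 + u (9 - 2 * x) / 7
  else if x ≤ 3 then 18 - 6 * x else if x ≤ 4 then 7 * x - 21 else if x ≤ 5 then 35 - 7 * x
  else if x ≤ 6 then u (18 - 3 * x) / 7 else u (7 * x - 42) / 7

/-- The values at 6, 7, 0 glue the pieces at the breakpoints 2, 4, 5; the other breakpoints match
for every `u`. -/
theorem continuous_leftOperator {u : ℝ → ℝ} (hu : Continuous u) (h0 : u 0 = 0) (h6 : u 6 = 0)
    (h7 : u 7 = 7) : Continuous (leftOperator u) := by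
  unfold leftOperator
  refine Continuous.if_le (by fun_prop) (Continuous.if_le (by fun_prop) (Continuous.if_le
    (by fun_prop) (Continuous.if_le (by fun_prop) (Continuous.if_le (by fun_prop) (Continuous.if_le
    (by fun_prop) (by fun_prop) continuous_id continuous_const ?_) continuous_id continuous_const
    ?_) continuous_id continuous_const ?_) continuous_id continuous_const ?_) continuous_id
    continuous_const ?_) continuous_id continuous_const ?_ <;>
  · rintro x rfl
    norm_num [h0, h6, h7]

/-- The values at 5 and 3 glue the pieces at 2 and 5. -/
theorem continuous_rightOperator {u : ℝ → ℝ} (hu : Continuous u) (h3 : u 3 = 0) (h5 : u 5 = 0) :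
    Continuous (rightOperator u) := by
  unfold rightOperator
  refine Continuous.if_le (by fun_prop) (Continuous.if_le (by fun_prop) (Continuous.if_le
    (by fun_prop) (Continuous.if_le (by fun_prop) (Continuous.if_le (by fun_prop) (Continuous.if_le
    (by fun_prop) (by fun_prop) continuous_id continuous_const ?_) continuous_id continuous_const
    ?_) continuous_id continuous_const ?_) continuous_id continuous_const ?_) continuous_id
    continuous_const ?_) continuous_id continuous_const ?_ <;>
  · rintro x rfl
    norm_num [h3, h5]

theorem leftOperator_mem {u : ℝ → ℝ} (hu : ∀ x, u x ∈ Set.Icc (0 : ℝ) 7) {x : ℝ} (h0 : 0 ≤ x)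
    (h7 : x ≤ 7) : leftOperator u x ∈ Set.Icc (0 : ℝ) 7 := by
  unfold leftOperator
  split_ifs
  case pos => constructor <;> linarith
  case pos => constructor <;> linarith
  case pos => constructor <;> linarith [(hu (18 - 6 * x)).1, (hu (18 - 6 * x)).2]
  case pos => constructor <;> linarith [(hu (7 * x - 21)).1, (hu (7 * x - 21)).2]
  case pos => constructor <;> linarith [(hu (35 - 7 * x)).1, (hu (35 - 7 * x)).2]
  case pos => constructor <;> linarith
  case neg => constructor <;> linarith

theorem rightOperator_mem {u : ℝ → ℝ} (hu : ∀ x, u x ∈ Set.Icc (0 : ℝ) 7) (x : ℝ) :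
    rightOperator u x ∈ Set.Icc (0 : ℝ) 7 := by
  unfold rightOperator
  split_ifs
  case pos => constructor <;> linarith [(hu (7 * x)).1, (hu (7 * x)).2]
  case pos => constructor <;> linarith [(hu (9 - 2 * x)).1, (hu (9 - 2 * x)).2]
  case pos => constructor <;> linarith
  case pos => constructor <;> linarith
  case pos => constructor <;> linarith
  case pos => constructor <;> linarith [(hu (18 - 3 * x)).1, (hu (18 - 3 * x)).2]
  case neg => constructor <;> linarith [(hu (7 * x - 42)).1, (hu (7 * x - 42)).2]

theorem leftOperator_contraction (u v : ℝ →ᵇ ℝ) (x : ℝ) :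
    |leftOperator u x - leftOperator v x| ≤ dist u v / 7 := by
  have h : ∀ y, |u y - v y| ≤ dist u v := fun y => by
    rw [← Real.dist_eq]; exact BoundedContinuousFunction.dist_coe_le_dist y
  have h' := fun y => abs_le.1 (h y)
  have hd : 0 ≤ dist u v := dist_nonneg
  unfold leftOperator
  split_ifs <;> rw [abs_le]
  case pos => constructor <;> linarith
  case pos => constructor <;> linarith
  case pos => constructor <;> linarith [(h' (18 - 6 * x)).1, (h' (18 - 6 * x)).2]
  case pos => constructor <;> linarith [(h' (7 * x - 21)).1, (h' (7 * x - 21)).2]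
  case pos => constructor <;> linarith [(h' (35 - 7 * x)).1, (h' (35 - 7 * x)).2]
  case pos => constructor <;> linarith
  case neg => constructor <;> linarith

theorem rightOperator_contraction (u v : ℝ →ᵇ ℝ) (x : ℝ) :
    |rightOperator u x - rightOperator v x| ≤ dist u v / 7 := by
  have h : ∀ y, |u y - v y| ≤ dist u v := fun y => by
    rw [← Real.dist_eq]; exact BoundedContinuousFunction.dist_coe_le_dist y
  have h' := fun y => abs_le.1 (h y)
  have hd : 0 ≤ dist u v := dist_nonneg
  unfold rightOperator
  split_ifs <;> rw [abs_le]
  case pos => constructor <;> linarith [(h' (7 * x)).1, (h' (7 * x)).2]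
  case pos => constructor <;> linarith [(h' (9 - 2 * x)).1, (h' (9 - 2 * x)).2]
  case pos => constructor <;> linarith
  case pos => constructor <;> linarith
  case pos => constructor <;> linarith
  case pos => constructor <;> linarith [(h' (18 - 3 * x)).1, (h' (18 - 3 * x)).2]
  case neg => constructor <;> linarith [(h' (7 * x - 42)).1, (h' (7 * x - 42)).2]

/-- A continuous function on the line with values in `[0, 7]`, as a bounded function. -/
noncomputable def boundedOfMemIcc (u : ℝ → ℝ) (hc : Continuous u)
    (hu : ∀ x, u x ∈ Set.Icc (0 : ℝ) 7) : ℝ →ᵇ ℝ :=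
  BoundedContinuousFunction.mkOfBound ⟨u, hc⟩ 7 fun x y => by
    change |u x - u y| ≤ 7
    rw [abs_le]
    constructor <;> linarith [(hu x).1, (hu x).2, (hu y).1, (hu y).2]

theorem isClosed_setOf_forall_mem_Icc :
    IsClosed {u : ℝ →ᵇ ℝ | ∀ x, u x ∈ Set.Icc (0 : ℝ) 7} := by
  simp only [Set.ofPred_forall]
  exact isClosed_iInter fun x =>
    isClosed_Icc.preimage (continuous_eval_const x)

theorem isClosed_setOf_apply_eq (x c : ℝ) : IsClosed {u : ℝ →ᵇ ℝ | u x = c} :=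
  isClosed_eq (continuous_eval_const x) continuous_const

theorem exists_left_fixed : ∃ u : ℝ → ℝ, Continuous u ∧ (∀ x, u x ∈ Set.Icc (0 : ℝ) 7) ∧
    (u 0 = 0 ∧ u 6 = 0 ∧ u 7 = 7) ∧ ∀ x, 0 ≤ x → x ≤ 7 → u x = leftOperator u x := by
  obtain ⟨u, ⟨hu, h0, h6, h7⟩, hfix⟩ := exists_fixedPoint_of_pointwise_contraction
    (S := {u : ℝ →ᵇ ℝ | ∀ x, u x ∈ Set.Icc (0 : ℝ) 7} ∩ ({u | u 0 = 0} ∩ ({u | u 6 = 0} ∩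
      {u | u 7 = 7})))
    (isClosed_setOf_forall_mem_Icc.inter ((isClosed_setOf_apply_eq _ _).inter
      ((isClosed_setOf_apply_eq _ _).inter (isClosed_setOf_apply_eq _ _))))
    ⟨boundedOfMemIcc (fun x => clampSeven (7 * x - 42))
      (continuous_clampSeven.comp (by fun_prop))
      fun x => ⟨clampSeven_nonneg _, clampSeven_le _⟩, fun x => ⟨clampSeven_nonneg _,
      clampSeven_le _⟩, by change clampSeven _ = 0; norm_num [clampSeven],
      by change clampSeven _ = 0; norm_num [clampSeven],
      by change clampSeven _ = 7; norm_num [clampSeven]⟩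
    -- Without the clamp the outer linear pieces would be unbounded on the line.
    (fun u x => leftOperator u (clampSeven x))
    (fun u ⟨hu, h0, h6, h7⟩ => by
      have hm : ∀ x, leftOperator u (clampSeven x) ∈ Set.Icc (0 : ℝ) 7 := fun x =>
        leftOperator_mem hu (clampSeven_nonneg x) (clampSeven_le x)
      refine ⟨boundedOfMemIcc _ ((continuous_leftOperator u.continuous h0 h6 h7).comp
        continuous_clampSeven) hm, ⟨hm, ?_, ?_, ?_⟩, rfl⟩
      -- The operator's values at 0, 6, 7 do not involve `u`, so the gluing conditions reproduce
      -- themselves.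
      · change leftOperator u (clampSeven 0) = 0
        norm_num [clampSeven, leftOperator]
      · change leftOperator u (clampSeven 6) = 0
        norm_num [clampSeven, leftOperator]
      · change leftOperator u (clampSeven 7) = 7
        norm_num [clampSeven, leftOperator])
    fun u v x => leftOperator_contraction u v _
  exact ⟨u, u.continuous, hu, ⟨h0, h6, h7⟩, fun x hx hx' => by
    conv_lhs => rw [← hfix]
    simp only [clampSeven_of_mem hx hx']⟩

theorem exists_right_fixed : ∃ u : ℝ → ℝ, Continuous u ∧ (∀ x, u x ∈ Set.Icc (0 : ℝ) 7) ∧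
    (u 3 = 0 ∧ u 5 = 0) ∧ ∀ x, 0 ≤ x → x ≤ 7 → u x = rightOperator u x := by
  obtain ⟨u, ⟨hu, h3, h5⟩, hfix⟩ := exists_fixedPoint_of_pointwise_contraction
    (S := {u : ℝ →ᵇ ℝ | ∀ x, u x ∈ Set.Icc (0 : ℝ) 7} ∩ ({u | u 3 = 0} ∩ {u | u 5 = 0}))
    (isClosed_setOf_forall_mem_Icc.inter ((isClosed_setOf_apply_eq _ _).inter
      (isClosed_setOf_apply_eq _ _)))
    ⟨0, fun x => ⟨le_rfl, by norm_num⟩, rfl, rfl⟩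
    (fun u x => rightOperator u (clampSeven x))
    (fun u ⟨hu, h3, h5⟩ => by
      have hm : ∀ x, rightOperator u (clampSeven x) ∈ Set.Icc (0 : ℝ) 7 := fun x =>
        rightOperator_mem hu _
      refine ⟨boundedOfMemIcc _ ((continuous_rightOperator u.continuous h3 h5).comp
        continuous_clampSeven) hm, ⟨hm, ?_, ?_⟩, rfl⟩
      · change rightOperator u (clampSeven 3) = 0
        norm_num [clampSeven, rightOperator]
      · change rightOperator u (clampSeven 5) = 0
        norm_num [clampSeven, rightOperator])
    fun u v x => rightOperator_contraction u v _
  exact ⟨u, u.continuous, hu, ⟨h3, h5⟩, fun x hx hx' => by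
    conv_lhs => rw [← hfix]
    simp only [clampSeven_of_mem hx hx']⟩

/-! ### The commuting pair on the interval -/

/-- Commuting maps of `[0, 7]` onto itself, given as functions on the line, without a common fixed
point. -/
theorem exists_commuting_real : ∃ f g : ℝ → ℝ, Continuous f ∧ Continuous g ∧
    (∀ x, f x ∈ Set.Icc (0 : ℝ) 7) ∧ (∀ x, g x ∈ Set.Icc (0 : ℝ) 7) ∧
    (f 0 = 0 ∧ f 7 = 7) ∧ (g 3 = 0 ∧ g 4 = 7) ∧
    ∀ x ∈ Set.Icc (0 : ℝ) 7, f (g x) = g (f x) ∧ ¬ (f x = x ∧ g x = x) := by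
  obtain ⟨f, hfc, hf, ⟨f0, f6, f7⟩, hfe⟩ := exists_left_fixed
  obtain ⟨g, hgc, hg, ⟨g3, g5⟩, hge⟩ := exists_right_fixed
  have fa : ∀ x, 0 ≤ x → x ≤ 1 → f x = 7 * x := fun x h h' => by
    rw [hfe x h (by linarith), leftOperator, if_pos h']
  have fb : ∀ x, 1 < x → x ≤ 2 → f x = 9 - 2 * x := fun x h h' => by
    rw [hfe x (by linarith) (by linarith), leftOperator, if_neg (by linarith), if_pos h']
  have fc : ∀ x, 2 < x → x ≤ 3 → f x = 5 - f (18 - 6 * x) / 7 := fun x h h' => by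
    rw [hfe x (by linarith) (by linarith), leftOperator, if_neg (by linarith),
      if_neg (by linarith), if_pos h']
  have fd : ∀ x, 3 < x → x ≤ 4 → f x = 5 - f (7 * x - 21) / 7 := fun x h h' => by
    rw [hfe x (by linarith) (by linarith), leftOperator, if_neg (by linarith),
      if_neg (by linarith), if_neg (by linarith), if_pos h']
  have fe : ∀ x, 4 < x → x ≤ 5 → f x = 3 + f (35 - 7 * x) / 7 := fun x h h' => by
    rw [hfe x (by linarith) (by linarith), leftOperator, if_neg (by linarith),
      if_neg (by linarith), if_neg (by linarith), if_neg (by linarith), if_pos h']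
  have ff : ∀ x, 5 < x → x ≤ 6 → f x = 18 - 3 * x := fun x h h' => by
    rw [hfe x (by linarith) (by linarith), leftOperator, if_neg (by linarith),
      if_neg (by linarith), if_neg (by linarith), if_neg (by linarith), if_neg (by linarith),
      if_pos h']
  -- The closed endpoint is needed: this is applied at `g x`, which is only known to be at least 6.
  have fg : ∀ x, 6 ≤ x → x ≤ 7 → f x = 7 * x - 42 := fun x h h' => by
    rcases h.eq_or_lt with rfl | h
    · rw [f6]; norm_num
    rw [hfe x (by linarith) h', leftOperator, if_neg (by linarith),
      if_neg (by linarith), if_neg (by linarith), if_neg (by linarith), if_neg (by linarith),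
      if_neg (by linarith)]
  have ga : ∀ x, 0 ≤ x → x ≤ 1 → g x = 6 + g (7 * x) / 7 := fun x h h' => by
    rw [hge x h (by linarith), rightOperator, if_pos h']
  have gb : ∀ x, 1 < x → x ≤ 2 → g x = 6 + g (9 - 2 * x) / 7 := fun x h h' => by
    rw [hge x (by linarith) (by linarith), rightOperator, if_neg (by linarith), if_pos h']
  have gc : ∀ x, 2 < x → x ≤ 3 → g x = 18 - 6 * x := fun x h h' => by
    rw [hge x (by linarith) (by linarith), rightOperator, if_neg (by linarith),
      if_neg (by linarith), if_pos h']
  have gd : ∀ x, 3 < x → x ≤ 4 → g x = 7 * x - 21 := fun x h h' => by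
    rw [hge x (by linarith) (by linarith), rightOperator, if_neg (by linarith),
      if_neg (by linarith), if_neg (by linarith), if_pos h']
  have ge : ∀ x, 4 ≤ x → x ≤ 5 → g x = 35 - 7 * x := fun x h h' => by
    rcases h.eq_or_lt with rfl | h
    · rw [gd 4 (by norm_num) le_rfl]; norm_num
    rw [hge x (by linarith) (by linarith), rightOperator, if_neg (by linarith),
      if_neg (by linarith), if_neg (by linarith), if_neg (by linarith), if_pos h']
  have gd' : ∀ x, 3 ≤ x → x ≤ 4 → g x = 7 * x - 21 := fun x h h' => by
    rcases h.eq_or_lt with rfl | h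
    · rw [g3]; norm_num
    exact gd x h h'
  have gf : ∀ x, 5 < x → x ≤ 6 → g x = g (18 - 3 * x) / 7 := fun x h h' => by
    rw [hge x (by linarith) (by linarith), rightOperator, if_neg (by linarith),
      if_neg (by linarith), if_neg (by linarith), if_neg (by linarith), if_neg (by linarith),
      if_pos h']
  have gg : ∀ x, 6 < x → x ≤ 7 → g x = g (7 * x - 42) / 7 := fun x h h' => by
    rw [hge x (by linarith) h', rightOperator, if_neg (by linarith),
      if_neg (by linarith), if_neg (by linarith), if_neg (by linarith), if_neg (by linarith),
      if_neg (by linarith)]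
  refine ⟨f, g, hfc, hgc, hf, hg, ⟨f0, f7⟩, ⟨g3, ?_⟩, fun x ⟨hx0, hx7⟩ => ?_⟩
  · rw [gd 4 (by norm_num) le_rfl]; norm_num
  have hf' := fun y => (hf y).1
  have hf'' := fun y => (hf y).2
  have hg' := fun y => (hg y).1
  have hg'' := fun y => (hg y).2
  rcases le_or_gt x 1 with h1 | h1
  · have e := fa x hx0 h1
    have e' := ga x hx0 h1
    refine ⟨?_, fun h => by linarith [hg' (7 * x)]⟩
    -- `g x` lies in `[6, 7]` and is the preimage of `g (f x)` under the branch of `f` there; the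
    -- other pieces follow the same pattern.
    rw [e, fg _ (by linarith [hg' (7 * x)]) (hg'' x), e']
    ring
  rcases le_or_gt x 2 with h2 | h2
  · have e := fb x h1 h2
    have e' := gb x h1 h2
    refine ⟨?_, fun h => by linarith [hg' (9 - 2 * x)]⟩
    rw [e, fg _ (by linarith [hg' (9 - 2 * x)]) (hg'' x), e']
    ring
  rcases le_or_gt x 3 with h3 | h3
  · have e := fc x h2 h3
    have e' := gc x h2 h3
    have b := hf' (18 - 6 * x)
    have b' := hf'' (18 - 6 * x)
    refine ⟨?_, fun h => by linarith⟩
    rw [e', ge (f x) (by linarith) (by linarith), e]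
    ring
  rcases le_or_gt x 4 with h4 | h4
  · have e := fd x h3 h4
    have e' := gd x h3 h4
    have b := hf' (7 * x - 21)
    have b' := hf'' (7 * x - 21)
    -- `g x = x` forces `x = 7/2`, whereas `f x ≥ 4`.
    refine ⟨?_, fun h => by linarith⟩
    rw [e', ge (f x) (by linarith) (by linarith), e]
    ring
  rcases le_or_gt x 5 with h5 | h5
  · have e := fe x h4 h5
    have e' := ge x h4.le h5
    have b := hf' (35 - 7 * x)
    have b' := hf'' (35 - 7 * x)
    refine ⟨?_, fun h => by linarith⟩
    rw [e', gd' (f x) (by linarith) (by linarith), e]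
    ring
  rcases le_or_gt x 6 with h6 | h6
  · have e := ff x h5 h6
    have e' := gf x h5 h6
    have b := hg' (18 - 3 * x)
    have b' := hg'' (18 - 3 * x)
    refine ⟨?_, fun h => by linarith⟩
    rw [e, fa (g x) (hg' x) (by linarith), e']
    ring
  · have e := fg x h6.le hx7
    have e' := gg x h6 hx7
    have b := hg' (7 * x - 42)
    have b' := hg'' (7 * x - 42)
    refine ⟨?_, fun h => by linarith⟩
    rw [e, fa (g x) (hg' x) (by linarith), e']
    ring

theorem exists_isCommutingSurjectionPair : ∃ f g : C(I, I), IsCommutingSurjectionPair f g := by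
  obtain ⟨f, g, hfc, hgc, hf, hg, ⟨f0, f7⟩, ⟨g3, g4⟩, h⟩ := exists_commuting_real
  have key : ∀ u : ℝ → ℝ, Continuous u → (∀ x, u x ∈ Set.Icc (0 : ℝ) 7) →
      ∃ v : C(I, I), ∀ x, (v x : ℝ) = u (7 * x) / 7 := fun u hc hu =>
    ⟨⟨fun x => ⟨u (7 * x) / 7, div_nonneg (hu _).1 (by norm_num),
      div_le_one_of_le₀ (hu _).2 (by norm_num)⟩, by fun_prop⟩, fun x => rfl⟩
  have surj : ∀ v : C(I, I), (∃ a, v a = 0) → (∃ b, v b = 1) → Function.Surjective v := by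
    rintro v ⟨a, ha⟩ ⟨b, hb⟩ y
    -- Intermediate value theorem.
    exact mem_range_of_exists_le_of_exists_ge v.continuous ⟨a, ha ▸ y.2.1⟩ ⟨b, hb ▸ y.2.2⟩
  obtain ⟨F, hF⟩ := key f hfc hf
  obtain ⟨G, hG⟩ := key g hgc hg
  have hI : ∀ x : I, 7 * (x : ℝ) ∈ Set.Icc (0 : ℝ) 7 := fun x =>
    ⟨by linarith [x.2.1], by linarith [x.2.2]⟩
  refine ⟨F, G, surj F ⟨0, ?_⟩ ⟨1, ?_⟩, surj G ⟨⟨3 / 7, by norm_num, by norm_num⟩, ?_⟩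
    ⟨⟨4 / 7, by norm_num, by norm_num⟩, ?_⟩, ?_, ?_⟩
  · ext; simp [hF, f0]
  · ext; simp [hF, f7]
  · ext; norm_num [hG, g3]
  · ext; norm_num [hG, g4]
  · ext x
    simp only [ContinuousMap.comp_apply, hF, hG, mul_div_cancel₀ _ (show (7 : ℝ) ≠ 0 by norm_num)]
    rw [(h _ (hI x)).1]
  · refine Set.eq_empty_of_forall_notMem fun x ⟨hx, hx'⟩ => (h _ (hI x)).2 ?_
    have e := congrArg Subtype.val (show F x = x from hx)
    have e' := congrArg Subtype.val (show G x = x from hx')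
    rw [hF] at e
    rw [hG] at e'
    constructor <;> linarith

/-! ### Inverse limits as nested intersections -/

/-- Disjoint open sets separating two closed parts of the intersection already cover some `K n` by
compactness, and that `K n` lies in one of them. -/
theorem isPreconnected_iInter_of_antitone {Y : Type*} [TopologicalSpace Y] [T2Space Y]
    {K : ℕ → Set Y} (hK : Antitone K) (hc : ∀ n, IsCompact (K n))
    (hp : ∀ n, IsPreconnected (K n)) : IsPreconnected (⋂ n, K n) := by
  have hcl : IsClosed (⋂ n, K n) := isClosed_iInter fun n => (hc n).isClosed
  have hcpt : IsCompact (⋂ n, K n) :=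
    (hc 0).of_isClosed_subset hcl (Set.iInter_subset _ 0)
  rw [isPreconnected_iff_subset_of_disjoint_closed]
  intro A B hA hB hcov hdisj
  obtain ⟨U, V, hU, hV, hAU, hBV, hUV⟩ := SeparatedNhds.of_isCompact_isCompact
    (hcpt.inter_right hA) (hcpt.inter_right hB) (Set.disjoint_left.2 fun x h h' =>
      Set.notMem_empty x (hdisj ▸ ⟨h.1, h.2, h'.2⟩))
  have hsub : ⋂ n, K n ⊆ U ∪ V := fun x hx =>
    (hcov hx).imp (fun h => hAU ⟨hx, h⟩) fun h => hBV ⟨hx, h⟩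
  obtain ⟨n, hn⟩ := exists_subset_nhds_of_isCompact hK.directed_ge hc
    fun x hx => (hU.union hV).mem_nhds (hsub hx)
  refine ((hp n).subset_or_subset hU hV hUV hn).imp (fun h x hx => ?_) fun h x hx => ?_
  · exact (hcov hx).resolve_right fun hxB =>
      Set.disjoint_left.1 hUV (h (Set.mem_iInter.1 hx n)) (hBV ⟨hx, hxB⟩)
  · exact (hcov hx).resolve_left fun hxA =>
      Set.disjoint_left.1 hUV (hAU ⟨hx, hxA⟩) (h (Set.mem_iInter.1 hx n))

/-- The sequences satisfying the first `n` relations of the inverse limit of `h`. -/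
def truncatedLimit (h : C(I, I)) (n : ℕ) : Set (ℕ → I) :=
  {x | ∀ i < n, h (x (i + 1)) = x i}

theorem isClosed_truncatedLimit (h : C(I, I)) (n : ℕ) : IsClosed (truncatedLimit h n) := by
  simp only [truncatedLimit, Set.ofPred_forall]
  exact isClosed_iInter fun i => isClosed_iInter fun _ =>
    isClosed_eq (h.continuous.comp (continuous_apply _)) (continuous_apply _)

/-- Coordinates from `n` on are free and determine the earlier ones; for `i ≥ n` truncated
subtraction leaves zero iterates. -/
theorem truncatedLimit_eq_range (h : C(I, I)) (n : ℕ) :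
    truncatedLimit h n = Set.range fun x : ℕ → I => fun i => h^[n - i] (x (max i n)) := by
  ext x
  constructor
  · intro hx
    have key : ∀ k ≤ n, h^[k] (x n) = x (n - k) := by
      intro k hk
      induction k with
      | zero => rfl
      | succ k ih =>
        rw [Function.iterate_succ_apply', ih (by omega), ← hx (n - (k + 1)) (by omega)]
        congr 2
        omega
    refine ⟨x, funext fun i => ?_⟩
    rcases le_total i n with hi | hi
    · simp only [max_eq_right hi]
      rw [key _ (Nat.sub_le n i), Nat.sub_sub_self hi]
    · simp only [max_eq_left hi, Nat.sub_eq_zero_of_le hi, Function.iterate_zero, id]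
  · rintro ⟨y, rfl⟩ i hi
    have e : n - i = (n - (i + 1)) + 1 := by omega
    simp only [max_eq_right hi.le, max_eq_right (Nat.succ_le_of_lt hi), e,
      Function.iterate_succ_apply']

theorem isConnected_truncatedLimit (h : C(I, I)) (n : ℕ) : IsConnected (truncatedLimit h n) := by
  rw [truncatedLimit_eq_range]
  exact isConnected_range (continuous_pi fun i =>
    (h.continuous.iterate _).comp (continuous_apply _))

theorem inverseLimit_const_eq_iInter (h : C(I, I)) :
    inverseLimit (fun _ => h) = ⋂ n, truncatedLimit h n := by
  ext x
  simp only [inverseLimit, truncatedLimit, Set.mem_iInter, Set.mem_ofPred_eq]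
  exact ⟨fun hx n i _ => hx i, fun hx i => hx (i + 1) i (Nat.lt_succ_self i)⟩

theorem antitone_truncatedLimit (h : C(I, I)) : Antitone (truncatedLimit h) :=
  fun _ _ hmn _ hx i hi => hx i (hi.trans_le hmn)

theorem isArcLikeContinuum_inverseLimit_const (h : C(I, I)) :
    IsArcLikeContinuum (inverseLimit fun _ => h) := by
  have hc : ∀ n, IsCompact (truncatedLimit h n) := fun n => (isClosed_truncatedLimit h n).isCompact
  have hne : (inverseLimit fun _ => h).Nonempty := by
    rw [inverseLimit_const_eq_iInter]
    exact IsCompact.nonempty_iInter_of_directed_nonempty_isCompact_isClosed _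
      (antitone_truncatedLimit h).directed_ge (fun n => (isConnected_truncatedLimit h n).nonempty)
      hc (isClosed_truncatedLimit h)
  have hconn : IsConnected (inverseLimit fun _ => h) := by
    refine ⟨hne, ?_⟩
    rw [inverseLimit_const_eq_iInter]
    exact isPreconnected_iInter_of_antitone (antitone_truncatedLimit h) hc
      fun n => (isConnected_truncatedLimit h n).isPreconnected
  have hcl : IsClosed (inverseLimit fun _ => h) := by
    rw [inverseLimit_const_eq_iInter]
    exact isClosed_iInter (isClosed_truncatedLimit h)
  exact ⟨⟨isCompact_iff_compactSpace.1 hcl.isCompact, isConnected_iff_connectedSpace.1 hconn,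
    inferInstance⟩, ⟨fun _ => h, ⟨Homeomorph.refl _⟩⟩⟩

/-! ### Commuting homeomorphisms of the inverse limit -/

/-- If `f` and `g` commute, then `f` acts coordinatewise as a homeomorphism on the inverse limit
of `f ∘ g`; its inverse is the shift followed by `g`. -/
def coordinatewiseHomeomorph (f g h : C(I, I)) (hfg : f.comp g = h) (hgf : g.comp f = h) :
    inverseLimit (fun _ => h) ≃ₜ inverseLimit (fun _ => h) where
  toFun x := ⟨fun i => f (x.1 i), fun i =>
    calc h (f (x.1 (i + 1))) = f (g (f (x.1 (i + 1)))) := (DFunLike.congr_fun hfg _).symm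
      _ = f (h (x.1 (i + 1))) := congrArg f (DFunLike.congr_fun hgf _)
      _ = f (x.1 i) := congrArg f (x.2 i)⟩
  invFun x := ⟨fun i => g (x.1 (i + 1)), fun i =>
    calc h (g (x.1 (i + 1 + 1))) = g (f (g (x.1 (i + 1 + 1)))) := (DFunLike.congr_fun hgf _).symm
      _ = g (h (x.1 (i + 1 + 1))) := congrArg g (DFunLike.congr_fun hfg _)
      _ = g (x.1 (i + 1)) := congrArg g (x.2 (i + 1))⟩
  left_inv x := Subtype.ext <| funext fun i =>
    (DFunLike.congr_fun hgf (x.1 (i + 1))).trans (x.2 i)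
  right_inv x := Subtype.ext <| funext fun i =>
    (DFunLike.congr_fun hfg (x.1 (i + 1))).trans (x.2 i)
  continuous_toFun := Continuous.subtype_mk (continuous_pi fun i =>
    f.continuous.comp ((continuous_apply i).comp continuous_subtype_val)) _
  continuous_invFun := Continuous.subtype_mk (continuous_pi fun i =>
    g.continuous.comp ((continuous_apply (i + 1)).comp continuous_subtype_val)) _

theorem exists_homeomorph_of_isCommutingSurjectionPair {f g : C(I, I)}
    (hfg : IsCommutingSurjectionPair f g) :
    IsArcLikeContinuum (inverseLimit fun _ => f.comp g) ∧
      ∃ F G : inverseLimit (fun _ => f.comp g) ≃ₜ inverseLimit (fun _ => f.comp g),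
        (∀ x i, (F x : ℕ → I) i = f ((x : ℕ → I) i)) ∧
        (∀ x i, (G x : ℕ → I) i = g ((x : ℕ → I) i)) ∧
        (F : inverseLimit (fun _ => f.comp g) → inverseLimit (fun _ => f.comp g)) ∘ G = G ∘ F ∧
        Function.fixedPoints F ∩ Function.fixedPoints G = ∅ := by
  refine ⟨isArcLikeContinuum_inverseLimit_const _,
    coordinatewiseHomeomorph f g _ rfl hfg.comm.symm,
    coordinatewiseHomeomorph g f _ hfg.comm.symm rfl, fun _ _ => rfl, fun _ _ => rfl, ?_, ?_⟩
  · exact funext fun x => Subtype.ext <| funext fun i => DFunLike.congr_fun hfg.comm (x.1 i)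
  · refine Set.eq_empty_of_forall_notMem fun x ⟨hx, hx'⟩ => ?_
    refine Set.notMem_empty (x.1 0) (hfg.no_common_fixed ▸ ⟨?_, ?_⟩)
    · exact congrFun (congrArg Subtype.val hx) 0
    · exact congrFun (congrArg Subtype.val hx') 0

theorem mainTheorem1 :
    -- an arc-like continuum with two commuting homeomorphisms without a common fixed point
    (∃ (X : Type) (_ : TopologicalSpace X), IsArcLikeContinuum X ∧
      ∃ F G : X ≃ₜ X, (F : X → X) ∘ G = G ∘ F ∧
        Function.fixedPoints F ∩ Function.fixedPoints G = ∅) ∧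
    -- commuting surjections of the interval without a common fixed point exist
    (∃ f g : C(I, I), IsCommutingSurjectionPair f g) ∧
    -- each such pair induces coordinatewise an example on the inverse limit under `h = f ∘ g`
    (∀ f g : C(I, I), IsCommutingSurjectionPair f g →
      IsArcLikeContinuum (inverseLimit fun _ => f.comp g) ∧
      ∃ F G : inverseLimit (fun _ => f.comp g) ≃ₜ inverseLimit (fun _ => f.comp g),
        (∀ x i, (F x : ℕ → I) i = f ((x : ℕ → I) i)) ∧
        (∀ x i, (G x : ℕ → I) i = g ((x : ℕ → I) i)) ∧
        (F : inverseLimit (fun _ => f.comp g) → inverseLimit (fun _ => f.comp g)) ∘ G = G ∘ F ∧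
        Function.fixedPoints F ∩ Function.fixedPoints G = ∅) := by
  obtain ⟨f, g, hfg⟩ := exists_isCommutingSurjectionPair
  refine ⟨?_, ⟨f, g, hfg⟩, fun f g h => exists_homeomorph_of_isCommutingSurjectionPair h⟩
  obtain ⟨hX, F, G, -, -, hFG, hfix⟩ := exists_homeomorph_of_isCommutingSurjectionPair hfg
  exact ⟨_, inferInstance, hX, F, G, hFG, hfix⟩
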